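/- **Theorem.** Let $p\ge 1$ be an integer and $h>0$. Let $B^{p,h}$ be the B-spline of order $p$ (degree $p-1$) with knot spacing $h$ centered at the origin, i.e. the B-spline given by the Cox–de Boor recursion on the equidistant knots $(j-\tfrac p2)h$, $j=0,\dots,p$ (starting from the indicator functions of the half-open knot intervals). Put $g^{p,h}=\frac1h B^{p,h}$ and let $$\rho(x)=\frac{1}{\sqrt{2\pi}\,\sigma}e^{-x^2/(2\sigma^2)},\qquad \sigma=\frac{\sqrt p}{2\sqrt3}\,h .$$ With the Fourier transform $\widehat f(\omega)=\int_{\mathbb R}f(x)e^{-i\omega x}\,dx$, for all $\omega\in\mathbb R$, $$\widehat g^{\,p,h}(\omega)=\left(\frac{\sin(h\omega/2)}{h\omega/2}\right)^p$$ (read as $1$ at $\omega=0$), and the following bounds hold. If $p<13$, then $$|\widehat\rho(\omega)-\widehat g^{\,p,h}(\omega)|\le\frac{4}{5e^2p}\left(1+\frac{17\ln p}{7p}\right)\quad\text{for } |\omega|\le\frac2h\sqrt{\frac{12\ln p}{p}} .$$ If $p\ge 13$, then $$|\widehat\rho(\omega)-\widehat g^{\,p,h}(\omega)|\le\begin{cases}\dfrac{4}{5e^2p}\left(1+\dfrac{17\ln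 p}{7p}\right)&\text{for }|\omega|<\dfrac2h\sqrt{\dfrac{12\ln p}{p}},\\[2mm]\dfrac{4(\ln p)^2}{5p^3}\left(1+\dfrac{17\ln p}{7p}\right)&\text{for }\dfrac2h\sqrt{\dfrac{12\ln p}{p}}\le|\omega|\le\dfrac{\pi}{h}.\end{cases}$$ For every $p\ge1$, $$|\widehat\rho(\omega)-\widehat g^{\,p,h}(\omega)|\le\exp\left(-\frac{p(h\omega)^2}{24}\right)+\left(\frac{2}{h|\omega|}\right)^p\quad\text{for }|\omega|>\frac{\pi}{h}.$$ Consequently, for every $\omega\in\mathbb R$ and $h>0$, $$\lim_{p\to\infty}\bigl(\widehat\rho(\omega)-\widehat g^{\,p,h}(\omega)\bigr)=0 .$$ -/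

import Mathlib

open Filter Topology

noncomputable section

/-- The B-spline basis functions of degree `d` attached to the knot sequence `z`, given by the
Cox-de Boor recursion: `coxDeBoor z d m` is supported between the knots `z m` and
`z (m + d + 1)`. -/
def coxDeBoor (z : ℕ → ℝ) : ℕ → ℕ → ℝ → ℝ
  | 0, m, x => if z m ≤ x ∧ x < z (m + 1) then 1 else 0
  | d + 1, m, x =>
      (x - z m) / (z (m + (d + 1)) - z m) * coxDeBoor z d m x
        + (z (m + (d + 1) + 1) - x) / (z (m + (d + 1) + 1) - z (m + 1))
            * coxDeBoor z d (m + 1) x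

/-- The B-spline `B^{p,h}` of order `p ≥ 1` (degree `p - 1`) with knot spacing `h`, centered at the
origin: its knots are the `p + 1` equidistant points `-p h / 2, ..., p h / 2`. -/
def centeredBSpline (p : ℕ) (h : ℝ) : ℝ → ℝ :=
  coxDeBoor (fun j => ((j : ℝ) - (p : ℝ) / 2) * h) (p - 1) 0

/-- The normalized B-spline `g^{p,h} = B^{p,h} / h`. -/
def normalizedBSpline (p : ℕ) (h : ℝ) (x : ℝ) : ℝ :=
  1 / h * centeredBSpline p h x

/-- The standard deviation `σ = √p h / (2 √3)`. -/
def splineSigma (p : ℕ) (h : ℝ) : ℝ :=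
  Real.sqrt p / (2 * Real.sqrt 3) * h

/-- The Gaussian `ρ(x) = exp (-x² / (2 σ²)) / (√(2π) σ)` with `σ = √p h / (2 √3)`. -/
def splineGaussian (p : ℕ) (h : ℝ) (x : ℝ) : ℝ :=
  1 / (Real.sqrt (2 * Real.pi) * splineSigma p h)
    * Real.exp (-x ^ 2 / (2 * splineSigma p h ^ 2))

/-- The Fourier transform in the angular frequency, `f̂(ω) = ∫ f(x) e^{-iωx} dx`. -/
def angularFourier (f : ℝ → ℝ) (ω : ℝ) : ℂ :=
  ∫ x : ℝ, (f x : ℂ) * Complex.exp (-(Complex.I * (ω : ℂ) * (x : ℂ)))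

end

/-!
Put `x = h |ω| / 2`. The transform of the Gaussian is `exp (-p x² / 6)`, and the transform of the
B-spline is `sinc x ^ p`. For the latter, multiplication by the variable becomes differentiation in `ω`,
so the Cox-de Boor recursion gives the transform in degree `d + 1` from that in degree `d` and its
derivative (`angularFourier_coxDeBoor_of_ne_zero`).

The theorem then compares `exp (-p x² / 6)` with `sinc x ^ p`. As
`-log (sinc x) = x² / 6 + x⁴ / 180 + ⋯`, one has
`exp (-(x² / 6 + r)) ≤ sinc x ≤ exp (-x² / 6)` with `r = x⁴ / 180 · (1 + 17 x² / 84)` as long as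
`x² ≤ 4.43` (`exp_neg_le_sinc`, `sinc_le_exp_neg_sq_div_six`); both bounds follow from a Riccati
comparison for the cotangent (`sinc_comparison`). Hence the error is at most
`exp (-p x² / 6) · p r`, which in the variable `y = p x² / 6` is
`y² exp (-y) / (5 p) · (1 + 17 x² / 84)`. The maximum of `y² exp (-y)` is at `y = 2` and gives the
bound for low frequencies, where `x² ≤ 12 log p / p ≤ 12 / e < 4.43`. For medium frequencies
`y ≥ 2 log p`, past the maximum, so the bound at `y = 2 log p` holds throughout. For
high frequencies the two transforms are estimated separately, by `|sinc x| ≤ 1 / |x|`. For a fixed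
`ω ≠ 0` both transforms are `p`-th powers of numbers of absolute value below `1`, so they tend
to `0`, while at `ω = 0` both are `1`.
-/

/-! ### Gaussian bounds for the cardinal sine -/

theorem hasDerivAt_sinc_of_ne_zero {x : ℝ} (hx : x ≠ 0) :
    HasDerivAt Real.sinc ((x * Real.cos x - Real.sin x) / x ^ 2) x := by
  have h := (Real.hasDerivAt_sin x).div (hasDerivAt_id x) hx
  refine (h.congr_of_eventuallyEq ?_).congr_deriv (by simp; ring)
  filter_upwards [isOpen_ne.mem_nhds hx] with y hy
  simp [Real.sinc_of_ne_zero hy]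

theorem sinc_abs (x : ℝ) : Real.sinc |x| = Real.sinc x := by
  rcases abs_choice x with h | h <;> simp [h, Real.sinc_neg]

/-- Comparison of `sinc` with `exp (-q)` through a Riccati inequality. For `ε = 1` it bounds `sinc`
from below, for `ε = -1` from above.

The sign of `(sinc · exp q)'` is that of `cot x - v`, where `v = 1 / x - q'`. Since `cot` solves the
Riccati equation `v' + v ^ 2 + 1 = 0`, it is compared with `v` by the sign of the residual
`v' + v ^ 2 + 1`, which equals `-(2 q' - x (1 - q'' + q' ^ 2)) / x`. -/
theorem sinc_comparison {q q' q'' : ℝ → ℝ} {a ε : ℝ} (ha : a ≤ Real.pi)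
    (hq : ∀ x, HasDerivAt q (q' x) x) (hq' : ∀ x, HasDerivAt q' (q'' x) x) (hq0 : q 0 = 0)
    (hric : ∀ x ∈ Set.Ioo 0 a, 0 ≤ ε * (2 * q' x - x * (1 - q'' x + q' x ^ 2)))
    {x : ℝ} (hx : x ∈ Set.Icc 0 a) :
    0 ≤ ε * (Real.sinc x * Real.exp (q x) - 1) := by
  have h0 : (0 : ℝ) ∈ Set.Icc 0 a := ⟨le_rfl, hx.1.trans hx.2⟩
  have hφ : ∀ x, HasDerivAt
      (fun x => ε * ((x * Real.cos x - (1 - x * q' x) * Real.sin x) * Real.exp (-q x)))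
      (Real.exp (-q x) * Real.sin x * (ε * (2 * q' x - x * (1 - q'' x + q' x ^ 2)))) x := by
    intro x
    have h1 := (hasDerivAt_id x).mul (Real.hasDerivAt_cos x)
    have h2 := (((hasDerivAt_id x).mul (hq' x)).const_sub 1).mul (Real.hasDerivAt_sin x)
    have h3 := ((h1.sub h2).mul (hq x).neg.exp).const_mul ε
    refine h3.congr_deriv ?_
    simp
    ring
  have hφ_mono := monotoneOn_of_deriv_nonneg (convex_Icc 0 a)
    (fun y _ => (hφ y).continuousAt.continuousWithinAt)
    (fun y _ => (hφ y).differentiableAt.differentiableWithinAt) (fun y hy => by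
      rw [interior_Icc] at hy
      rw [(hφ y).deriv]
      exact mul_nonneg (mul_nonneg (Real.exp_pos _).le
        (Real.sin_nonneg_of_nonneg_of_le_pi hy.1.le (hy.2.le.trans ha))) (hric y hy))
  have hψ : ∀ x ≠ 0, HasDerivAt (fun x => ε * (Real.sinc x * Real.exp (q x) - 1))
      (Real.exp (q x) ^ 2 / x ^ 2 *
        (ε * ((x * Real.cos x - (1 - x * q' x) * Real.sin x) * Real.exp (-q x)))) x := by
    intro x hx
    have h3 := (((hasDerivAt_sinc_of_ne_zero hx).mul (hq x).exp).sub_const 1).const_mul ε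
    refine h3.congr_deriv ?_
    rw [Real.sinc_of_ne_zero hx, Real.exp_neg]
    field_simp
    ring
  have hψ_mono := monotoneOn_of_deriv_nonneg
    (f := fun x => ε * (Real.sinc x * Real.exp (q x) - 1)) (convex_Icc 0 a)
    (fun y _ => (continuousAt_const.mul ((Real.continuous_sinc.continuousAt.mul
      (hq y).continuousAt.rexp).sub continuousAt_const)).continuousWithinAt)
    (fun y hy => by
      rw [interior_Icc] at hy
      exact (hψ y hy.1.ne').differentiableAt.differentiableWithinAt) (fun y hy => by
      rw [interior_Icc] at hy
      rw [(hψ y hy.1.ne').deriv]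
      have := hφ_mono h0 ⟨hy.1.le, hy.2.le⟩ hy.1.le
      simp only [Real.sin_zero, mul_zero, zero_mul, sub_zero] at this
      exact mul_nonneg (by positivity) this)
  simpa [hq0] using hψ_mono h0 hx hx.1

theorem sinc_le_exp_neg_sq_div_six {x : ℝ} (hx0 : 0 ≤ x) (hx : x ≤ Real.pi) :
    Real.sinc x ≤ Real.exp (-(x ^ 2 / 6)) := by
  have hq : ∀ x : ℝ, HasDerivAt (fun x : ℝ => x ^ 2 / 6) (x / 3) x := fun x =>
    ((hasDerivAt_pow 2 x).div_const 6).congr_deriv (by norm_num; ring)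
  have hq' : ∀ x : ℝ, HasDerivAt (fun x : ℝ => x / 3) (1 / 3) x := fun x =>
    (hasDerivAt_id x).div_const 3
  have h := sinc_comparison (ε := -1) le_rfl hq hq' (by norm_num) (fun y hy => by
    have := pow_pos hy.1 3
    linarith) ⟨hx0, hx⟩
  rw [Real.exp_neg, ← one_div, le_div_iff₀ (Real.exp_pos _)]
  linarith

/-- The exponent `x² / 6 + x⁴ / 180 · (1 + 17 x² / 84)` overestimates the logarithm of `1 / sinc x`,
since `1 / 180 · 17 / 84` exceeds the true third Taylor coefficient `1 / 2835`. The surplus absorbs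
all the later terms up to `x² = 4.43`. -/
theorem exp_neg_le_sinc {x : ℝ} (hx0 : 0 ≤ x) (hx : x ^ 2 ≤ 4.43) :
    Real.exp (-(x ^ 2 / 6 + x ^ 4 / 180 * (1 + 17 * x ^ 2 / 84))) ≤ Real.sinc x := by
  have hq : ∀ x : ℝ, HasDerivAt (fun x : ℝ => x ^ 2 / 6 + x ^ 4 / 180 * (1 + 17 * x ^ 2 / 84))
      (x / 3 + x ^ 3 / 45 + 17 * x ^ 5 / 2520) x := fun x => by
    have h := ((hasDerivAt_pow 2 x).div_const 6).add (((hasDerivAt_pow 4 x).div_const 180).mul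
      ((((hasDerivAt_pow 2 x).const_mul 17).div_const 84).const_add 1))
    refine h.congr_deriv ?_
    norm_num
    ring
  have hq' : ∀ x : ℝ, HasDerivAt (fun x : ℝ => x / 3 + x ^ 3 / 45 + 17 * x ^ 5 / 2520)
      (1 / 3 + x ^ 2 / 15 + 17 * x ^ 4 / 504) x := fun x => by
    have h := (((hasDerivAt_id x).div_const 3).add ((hasDerivAt_pow 3 x).div_const 45)).add
      (((hasDerivAt_pow 5 x).const_mul 17).div_const 2520)
    refine h.congr_deriv ?_
    norm_num
    ring
  have hx' : x ≤ 2.11 := by nlinarith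
  have h := sinc_comparison (ε := 1) (a := x) (by linarith [Real.pi_gt_three]) hq hq'
    (by norm_num) (fun y hy => by
    have hs : y ^ 2 ≤ 4.43 := (pow_le_pow_left₀ hy.1.le hy.2.le 2).trans hx
    have hs0 : 0 ≤ y ^ 2 := sq_nonneg y
    -- The left side increases with `y ^ 2`, so it is enough that it is negative at `y ^ 2 = 4.43`.
    have key : -(7 * 17 / 2520 - 2 / 135 : ℝ) + (1 / 2025 + 2 * 17 / 7560) * y ^ 2
        + 2 * 17 / 113400 * (y ^ 2) ^ 2 + (17 / 2520) ^ 2 * (y ^ 2) ^ 3 ≤ 0 := by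
      have h2 := pow_le_pow_left₀ hs0 hs 2
      have h3 := pow_le_pow_left₀ hs0 hs 3
      norm_num at h2 h3 hs ⊢
      linarith
    have h5 := mul_nonneg (pow_pos hy.1 5).le (neg_nonneg.2 key)
    refine h5.trans_eq ?_
    ring) ⟨hx0, le_rfl⟩
  rw [Real.exp_neg, ← one_div, div_le_iff₀ (Real.exp_pos _)]
  linarith

/-- The two-sided bound on `sinc`, raised to the power `p`, with `1 - exp (-t) ≤ t`. -/
theorem abs_exp_sub_sinc_pow_le (p : ℕ) {x : ℝ} (hx0 : 0 ≤ x) (hx : x ^ 2 ≤ 4.43) :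
    |Real.exp (-(p * x ^ 2 / 6)) - Real.sinc x ^ p| ≤
      Real.exp (-(p * x ^ 2 / 6)) * (p * (x ^ 4 / 180 * (1 + 17 * x ^ 2 / 84))) := by
  have hxπ : x ≤ Real.pi := by nlinarith [Real.pi_gt_three]
  have hl := exp_neg_le_sinc hx0 hx
  have hu := pow_le_pow_left₀ ((Real.exp_pos _).le.trans hl) (sinc_le_exp_neg_sq_div_six hx0 hxπ) p
  have hl' := pow_le_pow_left₀ (Real.exp_pos _).le hl p
  rw [← Real.exp_nat_mul] at hu hl'
  have e1 : (p : ℝ) * -(x ^ 2 / 6) = -(p * x ^ 2 / 6) := by ring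
  have e2 : (p : ℝ) * -(x ^ 2 / 6 + x ^ 4 / 180 * (1 + 17 * x ^ 2 / 84)) =
    -(p * x ^ 2 / 6) + -(p * (x ^ 4 / 180 * (1 + 17 * x ^ 2 / 84))) := by ring
  rw [e1] at hu
  rw [e2, Real.exp_add] at hl'
  rw [abs_of_nonneg (sub_nonneg.2 hu)]
  have h1 := Real.one_sub_le_exp_neg (p * (x ^ 4 / 180 * (1 + 17 * x ^ 2 / 84)))
  have h2 := mul_le_mul_of_nonneg_left h1 (Real.exp_pos (-(p * x ^ 2 / 6))).le
  linarith

theorem abs_sinc_lt_one {x : ℝ} (hx : x ≠ 0) : |Real.sinc x| < 1 := by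
  have hx' := abs_pos.2 hx
  rw [Real.sinc_of_ne_zero hx, abs_div, div_lt_one hx']
  exact Real.abs_sin_lt_abs hx

theorem abs_sinc_le_inv_abs {x : ℝ} (hx : x ≠ 0) : |Real.sinc x| ≤ |x|⁻¹ := by
  rw [Real.sinc_of_ne_zero hx, abs_div, ← one_div]
  gcongr
  exact Real.abs_sin_le_one x

/-! ### Bounds for the error term -/

/-- `y ^ n * exp (-y)` decreases beyond its maximum at `y = n`, and is at most the value there. -/
theorem pow_mul_exp_neg_le {n : ℕ} {y Y : ℝ} (hy : 0 ≤ y) (hY : 0 < Y)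
    (h : 0 ≤ (y - Y) * (Y - n)) : y ^ n * Real.exp (-y) ≤ Y ^ n * Real.exp (-Y) := by
  have h1 : y / Y ≤ Real.exp (y / Y - 1) := by linarith [Real.add_one_le_exp (y / Y - 1)]
  have h2 := pow_le_pow_left₀ (by positivity) h1 n
  rw [← Real.exp_nat_mul, div_pow, div_le_iff₀ (by positivity)] at h2
  have h3 : (n : ℝ) * (y / Y - 1) ≤ y - Y := by
    rw [div_sub_one hY.ne', mul_div_assoc', div_le_iff₀ hY]
    linarith
  calc y ^ n * Real.exp (-y) ≤ Real.exp (y - Y) * Y ^ n * Real.exp (-y) := by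
        gcongr
        exact h2.trans (by gcongr)
    _ = Y ^ n * Real.exp (-Y) := by
        rw [mul_right_comm, ← Real.exp_add, mul_comm]
        ring_nf

/-- The error bound rewritten in the variable `y = p x² / 6`, in which its main factor is
`y² exp (-y)`. -/
theorem exp_mul_error_eq {p : ℝ} (hp : 0 < p) (x : ℝ) :
    Real.exp (-(p * x ^ 2 / 6)) * (p * (x ^ 4 / 180 * (1 + 17 * x ^ 2 / 84))) =
      (p * x ^ 2 / 6) ^ 2 * Real.exp (-(p * x ^ 2 / 6)) / (5 * p) * (1 + 17 * x ^ 2 / 84) := by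
  field_simp
  ring

/-- Low frequencies: `y ^ 2 * exp (-y)` is bounded by its maximum `4 / e ^ 2`, at `y = 2`. -/
theorem error_le_of_sq_le {p : ℕ} (hp : 1 ≤ p) {x : ℝ} (hx0 : 0 ≤ x)
    (hx : x ^ 2 ≤ 12 * Real.log p / p) :
    |Real.exp (-(p * x ^ 2 / 6)) - Real.sinc x ^ p| ≤
      4 / (5 * Real.exp 1 ^ 2 * p) * (1 + 17 * Real.log p / (7 * p)) := by
  have hp' : (0 : ℝ) < p := by exact_mod_cast hp
  -- `log p / p ≤ 1 / e`, and `12 / e < 4.43`.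
  have hlog : 12 * Real.log p / p ≤ 4.43 := by
    have h1 := Real.add_one_le_exp (Real.log p - 1)
    rw [Real.exp_sub, Real.exp_log hp', sub_add_cancel, le_div_iff₀ (Real.exp_pos 1)] at h1
    have h2 := Real.exp_one_gt_d9
    have h3 : 0 ≤ Real.log p := Real.log_natCast_nonneg p
    rw [div_le_iff₀ hp']
    nlinarith
  refine (abs_exp_sub_sinc_pow_le p hx0 (hx.trans hlog)).trans ?_
  rw [exp_mul_error_eq hp']
  have h := pow_mul_exp_neg_le (n := 2) (y := p * x ^ 2 / 6) (Y := 2) (by positivity) (by norm_num)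
    (by norm_num)
  have e : 4 / (5 * Real.exp 1 ^ 2 * p) = 2 ^ 2 * Real.exp (-2) / (5 * p) := by
    rw [← Real.exp_nat_mul, Real.exp_neg]
    norm_num
    field_simp
  rw [e]
  gcongr ?_ / _ * (1 + ?_)
  calc 17 * x ^ 2 / 84 ≤ 17 * (12 * Real.log p / p) / 84 := by gcongr
    _ = 17 * Real.log p / (7 * p) := by field_simp; ring

/-- Medium frequencies: here `y = p x² / 6 ≥ 2 log p`, which exceeds `3`, so both `y ^ 2 * exp (-y)`
and `y ^ 3 * exp (-y)` are at most their values at `2 log p`, where `exp (-y) = 1 / p ^ 2`. -/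
theorem error_le_of_le_sq {p : ℕ} (hp : 13 ≤ p) {x : ℝ} (hx0 : 0 ≤ x)
    (hx : 12 * Real.log p / p ≤ x ^ 2) (hxπ : x ≤ Real.pi / 2) :
    |Real.exp (-(p * x ^ 2 / 6)) - Real.sinc x ^ p| ≤
      4 * Real.log p ^ 2 / (5 * p ^ 3) * (1 + 17 * Real.log p / (7 * p)) := by
  have hp13 : (13 : ℝ) ≤ p := by exact_mod_cast hp
  have hp' : (0 : ℝ) < p := by linarith
  have hlog : 2 ≤ Real.log p := by
    rw [Real.le_log_iff_exp_le hp']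
    have h2 := Real.exp_one_lt_three
    have h3 : Real.exp 2 = Real.exp 1 ^ 2 := by rw [← Real.exp_nat_mul]; norm_num
    nlinarith [Real.exp_pos 1]
  have hx2 : x ^ 2 ≤ 4.43 := by nlinarith [Real.pi_lt_d2]
  refine (abs_exp_sub_sinc_pow_le p hx0 hx2).trans ?_
  rw [exp_mul_error_eq hp']
  have hy : 2 * Real.log p ≤ p * x ^ 2 / 6 := by
    rw [div_le_iff₀ hp'] at hx
    linarith
  set y := p * x ^ 2 / 6 with hy_def
  have hxy : 17 * x ^ 2 / 84 = 17 / (14 * p) * y := by rw [hy_def]; field_simp; ring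
  have h2 := pow_mul_exp_neg_le (n := 2) (y := y) (Y := 2 * Real.log p) (by positivity)
    (by positivity) (mul_nonneg (by linarith) (by norm_num; linarith))
  have h3 := pow_mul_exp_neg_le (n := 3) (y := y) (Y := 2 * Real.log p) (by positivity)
    (by positivity) (mul_nonneg (by linarith) (by norm_num; linarith))
  have e : Real.exp (-(2 * Real.log p)) = 1 / p ^ 2 := by
    rw [Real.exp_neg, mul_comm, ← Nat.cast_ofNat, Real.exp_mul, Real.exp_log hp',
      Real.rpow_natCast, one_div]
  rw [e] at h2 h3
  calc y ^ 2 * Real.exp (-y) / (5 * p) * (1 + 17 * x ^ 2 / 84)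
      = (y ^ 2 * Real.exp (-y) + 17 / (14 * p) * (y ^ 3 * Real.exp (-y))) / (5 * p) := by
        rw [hxy]; ring
    _ ≤ ((2 * Real.log p) ^ 2 * (1 / p ^ 2)
          + 17 / (14 * p) * ((2 * Real.log p) ^ 3 * (1 / p ^ 2))) / (5 * p) := by gcongr
    _ = 4 * Real.log p ^ 2 / (5 * p ^ 3) * (1 + 17 * Real.log p / (7 * p)) := by
        field_simp
        ring

/-! ### The Fourier transform of the Gaussian -/

theorem angularFourier_splineGaussian {p : ℕ} {h : ℝ} (hp : 1 ≤ p) (hh : 0 < h) (ω : ℝ) :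
    angularFourier (splineGaussian p h) ω =
      ((Real.exp (-(p * (h * ω / 2) ^ 2 / 6)) : ℝ) : ℂ) := by
  have hp' : (0 : ℝ) < p := by exact_mod_cast hp
  have hσ : 0 < splineSigma p h := by unfold splineSigma; positivity
  have hσ2 : splineSigma p h ^ 2 = p * h ^ 2 / 12 := by
    unfold splineSigma
    rw [mul_pow, div_pow, mul_pow, Real.sq_sqrt hp'.le, Real.sq_sqrt (by norm_num)]
    ring
  set v : NNReal := ⟨splineSigma p h ^ 2, sq_nonneg _⟩ with hv
  have hv0 : v ≠ 0 := fun h0 => (pow_pos hσ 2).ne' (congrArg NNReal.toReal h0)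
  have hvc : (v : ℝ) = splineSigma p h ^ 2 := rfl
  have key := ProbabilityTheory.charFun_gaussianReal (μ := 0) (v := v) (-ω)
  rw [MeasureTheory.charFun_apply_real,
    ProbabilityTheory.integral_gaussianReal_eq_integral_smul hv0] at key
  unfold angularFourier
  have hpdf : ∀ x, ProbabilityTheory.gaussianPDFReal 0 v x = splineGaussian p h x := by
    intro x
    rw [ProbabilityTheory.gaussianPDFReal_def, splineGaussian, hvc,
      Real.sqrt_mul (by positivity), Real.sqrt_sq hσ.le]
    simp
  calc _ = ∫ x : ℝ, ProbabilityTheory.gaussianPDFReal 0 v x •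
        Complex.exp (((-ω : ℝ) : ℂ) * x * Complex.I) := by
        congr 1
        ext x
        rw [hpdf, Complex.real_smul]
        congr 2
        push_cast
        ring
    _ = _ := by
        rw [key, Complex.ofReal_exp]
        congr 1
        have : ((v : ℝ) : ℂ) = ((p * h ^ 2 / 12 : ℝ) : ℂ) := by rw [hvc, hσ2]
        rw [this]
        push_cast
        ring

/-! ### The Fourier transform of the B-splines -/

theorem norm_exp_neg_I_mul (ω x : ℝ) :
    ‖Complex.exp (-(Complex.I * (ω : ℂ) * (x : ℂ)))‖ = 1 := by
  rw [Complex.norm_exp]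
  simp

theorem integrable_mul_exp {f : ℝ → ℝ} (hf : MeasureTheory.Integrable f) (ω : ℝ) :
    MeasureTheory.Integrable
      (fun x : ℝ => (f x : ℂ) * Complex.exp (-(Complex.I * (ω : ℂ) * (x : ℂ)))) := by
  refine hf.ofReal.mul_bdd (c := 1) (by fun_prop) (MeasureTheory.ae_of_all _ fun x => ?_)
  exact (norm_exp_neg_I_mul ω x).le

theorem angularFourier_add {f g : ℝ → ℝ} (hf : MeasureTheory.Integrable f)
    (hg : MeasureTheory.Integrable g) (ω : ℝ) :
    angularFourier (fun x => f x + g x) ω = angularFourier f ω + angularFourier g ω := by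
  unfold angularFourier
  rw [← MeasureTheory.integral_add (integrable_mul_exp hf ω) (integrable_mul_exp hg ω)]
  congr 1
  ext x
  push_cast
  ring

theorem angularFourier_const_mul (c : ℝ) (f : ℝ → ℝ) (ω : ℝ) :
    angularFourier (fun x => c * f x) ω = c * angularFourier f ω := by
  unfold angularFourier
  rw [← MeasureTheory.integral_const_mul]
  congr 1
  ext x
  push_cast
  ring

theorem hasDerivAt_angularFourier {f : ℝ → ℝ} (hf : MeasureTheory.Integrable f)
    (hf' : MeasureTheory.Integrable fun x => x * f x) (ω : ℝ) :
    HasDerivAt (angularFourier f)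
      (-Complex.I * angularFourier (fun x => x * f x) ω) ω := by
  have h := (hasDerivAt_integral_of_dominated_loc_of_deriv_le (μ := MeasureTheory.volume)
    (F := fun (ω x : ℝ) => (f x : ℂ) * Complex.exp (-(Complex.I * (ω : ℂ) * (x : ℂ))))
    (F' := fun (ω x : ℝ) => -Complex.I *
      (((x * f x : ℝ) : ℂ) * Complex.exp (-(Complex.I * (ω : ℂ) * (x : ℂ)))))
    (bound := fun x => ‖x * f x‖) (x₀ := ω) (s := Set.univ) univ_mem
    (Eventually.of_forall fun w => (integrable_mul_exp hf w).aestronglyMeasurable)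
    (integrable_mul_exp hf ω)
    ((integrable_mul_exp hf' ω).const_mul _).aestronglyMeasurable
    (MeasureTheory.ae_of_all _ fun x w _ => ?_) hf'.norm (MeasureTheory.ae_of_all _ fun x w _ => ?_)).2
  · rw [MeasureTheory.integral_const_mul] at h
    exact h
  · rw [norm_mul, norm_mul, norm_exp_neg_I_mul, norm_neg, Complex.norm_I, Complex.norm_real,
      one_mul, mul_one]
  · have h1 : HasDerivAt (fun w : ℝ => -(Complex.I * (w : ℂ) * (x : ℂ)))
        (-(Complex.I * 1 * (x : ℂ))) w :=
      ((Complex.ofRealCLM.hasDerivAt.const_mul Complex.I).mul_const (x : ℂ)).neg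
    refine (h1.cexp.const_mul (f x : ℂ)).congr_deriv ?_
    push_cast
    ring

/-- The products with continuous functions, rather than just the B-splines themselves, make the
recursion close up: its coefficients are affine functions. -/
theorem integrable_mul_coxDeBoor (z : ℕ → ℝ) (d : ℕ) :
    ∀ (m : ℕ) {q : ℝ → ℝ}, Continuous q →
      MeasureTheory.Integrable fun x => q x * coxDeBoor z d m x := by
  induction d with
  | zero =>
    intro m q hq
    have h := ((hq.integrableOn_Icc (a := z m) (b := z (m + 1))).mono_set
      Set.Ico_subset_Icc_self (μ := MeasureTheory.volume)).integrable_indicator measurableSet_Ico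
    refine h.congr (MeasureTheory.ae_of_all _ fun x => ?_)
    simp [coxDeBoor, Set.indicator_apply, Set.mem_Ico]
  | succ d ih =>
    intro m q hq
    have h1 := ih m (q := fun x => q x * ((x - z m) / (z (m + (d + 1)) - z m))) (by fun_prop)
    have h2 := ih (m + 1) (q := fun x => q x * ((z (m + (d + 1) + 1) - x) /
      (z (m + (d + 1) + 1) - z (m + 1)))) (by fun_prop)
    refine (h1.add h2).congr (MeasureTheory.ae_of_all _ fun x => ?_)
    simp only [coxDeBoor, Pi.add_apply]
    ring

theorem integrable_coxDeBoor (z : ℕ → ℝ) (d m : ℕ) :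
    MeasureTheory.Integrable (coxDeBoor z d m) := by
  simpa using integrable_mul_coxDeBoor z d m (q := fun _ => 1) continuous_const

theorem integrable_id_mul_coxDeBoor (z : ℕ → ℝ) (d m : ℕ) :
    MeasureTheory.Integrable fun x => x * coxDeBoor z d m x :=
  integrable_mul_coxDeBoor z d m continuous_id

theorem continuous_angularFourier_coxDeBoor (z : ℕ → ℝ) (d m : ℕ) :
    Continuous (angularFourier (coxDeBoor z d m)) :=
  continuous_iff_continuousAt.2 fun ω => (hasDerivAt_angularFourier
    (integrable_coxDeBoor z d m) (integrable_id_mul_coxDeBoor z d m) ω).continuousAt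

theorem angularFourier_indicator_Ico {h ω : ℝ} (hh : 0 < h) (hω : ω ≠ 0) (a : ℝ) :
    angularFourier (fun x => if a ≤ x ∧ x < a + h then 1 else 0) ω =
      h * (Real.sinc (h * ω / 2) : ℂ) * Complex.exp (-(Complex.I * ω * (a + h / 2))) := by
  have hω' : (ω : ℂ) ≠ 0 := by exact_mod_cast hω
  have hh' : (h : ℂ) ≠ 0 := by exact_mod_cast hh.ne'
  have hc : -(Complex.I * ω) ≠ 0 := neg_ne_zero.2 (mul_ne_zero Complex.I_ne_zero hω')
  have h1 : angularFourier (fun x => if a ≤ x ∧ x < a + h then 1 else 0) ω =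
      ∫ x in a..(a + h), Complex.exp (-(Complex.I * ω) * x) := by
    rw [intervalIntegral.integral_of_le (by linarith), ← MeasureTheory.integral_Ico_eq_integral_Ioc,
      ← MeasureTheory.integral_indicator measurableSet_Ico]
    unfold angularFourier
    congr 1
    ext x
    by_cases hx : a ≤ x ∧ x < a + h <;> simp [hx, Set.mem_Ico]
  rw [h1, integral_exp_mul_complex hc, Real.sinc_of_ne_zero (by positivity)]
  have e1 : -(Complex.I * ω) * ((a + h : ℝ) : ℂ) =
    -(Complex.I * ω * (a + h / 2)) + -((h * ω / 2) * Complex.I) := by push_cast; ring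
  have e2 : -(Complex.I * ω) * (a : ℂ) =
    -(Complex.I * ω * (a + h / 2)) + (h * ω / 2) * Complex.I := by ring
  rw [e1, e2, Complex.exp_add, Complex.exp_add]
  push_cast
  rw [Complex.sin, neg_mul]
  field_simp
  ring_nf
  simp

/-- Multiplication of a function by `x` corresponds to `i d/dω` on its transform, so the
Cox-de Boor recursion becomes a first-order differential recursion for the transforms, which is
solved by the products below. The point `ω = 0`, where the cardinal sine needs a separate treatment, is
left out and is recovered by continuity. -/
theorem angularFourier_coxDeBoor_of_ne_zero {h : ℝ} (hh : 0 < h) (c : ℝ) (d : ℕ) :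
    ∀ (m : ℕ) {ω : ℝ}, ω ≠ 0 →
      angularFourier (coxDeBoor (fun j => ((j : ℝ) - c) * h) d m) ω =
        h * (Real.sinc (h * ω / 2) : ℂ) ^ (d + 1) *
          Complex.exp (-(Complex.I * ω * ((m + (d + 1) / 2 - c) * h))) := by
  induction d with
  | zero =>
    intro m ω hω
    have h0 : coxDeBoor (fun j => ((j : ℝ) - c) * h) 0 m =
        fun x => if (m - c) * h ≤ x ∧ x < (m - c) * h + h then 1 else 0 := by
      ext x
      have : (((m + 1 : ℕ) : ℝ) - c) * h = (m - c) * h + h := by push_cast; ring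
      simp only [coxDeBoor, this]
    rw [h0, angularFourier_indicator_Ico hh hω]
    push_cast
    ring_nf
  | succ d ih =>
    intro m ω hω
    set z : ℕ → ℝ := fun j => ((j : ℝ) - c) * h with hz
    have hu : h * ω / 2 ≠ 0 := by positivity
    have hω' : (ω : ℂ) ≠ 0 := by exact_mod_cast hω
    have hh' : (h : ℂ) ≠ 0 := by exact_mod_cast hh.ne'
    set s : ℂ := (Real.sinc (h * ω / 2) : ℂ) with hs
    set C : ℂ := Complex.cos (h * ω / 2)
    -- The transform of `x * N`, read off from the derivative of the formula for `N`.
    have hmoment : ∀ m : ℕ, angularFourier (fun x => x * coxDeBoor z d m x) ω =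
        (Complex.I * (d + 1) * h * s ^ d * ((C - s) / ω)
          + h * s ^ (d + 1) * ((m + (d + 1) / 2 - c) * h)) *
          Complex.exp (-(Complex.I * ω * ((m + (d + 1) / 2 - c) * h))) := by
      intro m
      have h1 := hasDerivAt_angularFourier (integrable_coxDeBoor z d m)
        (integrable_id_mul_coxDeBoor z d m) ω
      have h2 : HasDerivAt (fun w : ℝ => ((Real.sinc (h * w / 2) : ℝ) : ℂ)) ((C - s) / ω) ω := by
        have hlin : HasDerivAt (fun w : ℝ => h * w / 2) (h * 1 / 2) ω :=
          ((hasDerivAt_id ω).const_mul h).div_const 2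
        have := ((hasDerivAt_sinc_of_ne_zero hu).comp ω hlin).ofReal_comp
        refine this.congr_deriv ?_
        rw [hs, Real.sinc_of_ne_zero hu]
        simp only [C]
        push_cast
        field_simp
      have h3 : HasDerivAt
          (fun w : ℝ => -(Complex.I * (w : ℂ) * ((m + (d + 1) / 2 - c) * h)))
          (-(Complex.I * 1 * ((m + (d + 1) / 2 - c) * h))) ω :=
        ((Complex.ofRealCLM.hasDerivAt.const_mul Complex.I).mul_const _).neg
      have h4 := (((h2.pow (d + 1)).const_mul (h : ℂ)).mul h3.cexp)
      have h5 := h1.congr_of_eventuallyEq (f₁ := fun w : ℝ =>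
          h * (Real.sinc (h * w / 2) : ℂ) ^ (d + 1) *
          Complex.exp (-(Complex.I * w * ((m + (d + 1) / 2 - c) * h)))) (by
        filter_upwards [isOpen_ne.mem_nhds hω] with w hw
        exact (ih m hw).symm)
      have h6 := h5.unique h4
      have h7 : angularFourier (fun x => x * coxDeBoor z d m x) ω =
        Complex.I * (-Complex.I * angularFourier (fun x => x * coxDeBoor z d m x) ω) := by
        rw [← mul_assoc]
        simp
      rw [h7, h6]
      simp only [Pi.pow_apply, ← hs]
      push_cast
      linear_combination (-h * s ^ (d + 1) * ((m + (d + 1) / 2 - c) * h) *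
          Complex.exp (-(Complex.I * ω * ((m + (d + 1) / 2 - c) * h)))) * Complex.I_sq
    have hrec : coxDeBoor z (d + 1) m = fun x => 1 / ((d + 1) * h) *
        ((x * coxDeBoor z d m x + (-z m) * coxDeBoor z d m x)
          + (z (m + (d + 1) + 1) * coxDeBoor z d (m + 1) x
            + (-1) * (x * coxDeBoor z d (m + 1) x))) := by
      ext x
      have e1 : z (m + (d + 1)) - z m = (d + 1) * h := by simp only [hz]; push_cast; ring
      have e2 : z (m + (d + 1) + 1) - z (m + 1) = (d + 1) * h := by
        simp only [hz]; push_cast; ring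
      rw [coxDeBoor, e1, e2]
      ring
    have j1 := integrable_id_mul_coxDeBoor z d m
    have k1 := (integrable_coxDeBoor z d m).const_mul (-z m)
    have j2 := (integrable_id_mul_coxDeBoor z d (m + 1)).const_mul (-1)
    have k2 := (integrable_coxDeBoor z d (m + 1)).const_mul (z (m + (d + 1) + 1))
    rw [hrec, angularFourier_const_mul,
      angularFourier_add (f := fun x => x * coxDeBoor z d m x + -z m * coxDeBoor z d m x)
        (g := fun x => z (m + (d + 1) + 1) * coxDeBoor z d (m + 1) x +
          -1 * (x * coxDeBoor z d (m + 1) x)) (j1.add k1) (k2.add j2),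
      angularFourier_add j1 k1, angularFourier_add k2 j2,
      angularFourier_const_mul, angularFourier_const_mul, angularFourier_const_mul,
      hmoment, hmoment, ih m hω, ih (m + 1) hω]
    -- Both exponentials are shifts, by half a knot interval, of the one in the claim.
    have hsin : Complex.sin (h * ω / 2) = s * (h * ω / 2) := by
      rw [hs, Real.sinc_of_ne_zero hu]
      push_cast
      field_simp
    have e1 : Complex.exp (-(Complex.I * ω * ((m + (d + 1) / 2 - c) * h))) =
        Complex.exp (-(Complex.I * ω * ((m + ((d + 1 : ℕ) + 1) / 2 - c) * h))) *
          (C + s * (h * ω / 2) * Complex.I) := by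
      rw [← hsin, ← Complex.exp_mul_I, ← Complex.exp_add]
      push_cast
      ring_nf
    have e2 : Complex.exp (-(Complex.I * ω * (((m + 1 : ℕ) + (d + 1) / 2 - c) * h))) =
        Complex.exp (-(Complex.I * ω * ((m + ((d + 1 : ℕ) + 1) / 2 - c) * h))) *
          (C - s * (h * ω / 2) * Complex.I) := by
      have : C - s * (h * ω / 2) * Complex.I = Complex.exp (-(h * ω / 2) * Complex.I) := by
        rw [Complex.exp_mul_I, Complex.cos_neg, Complex.sin_neg, hsin]
        ring
      rw [this, ← Complex.exp_add]
      push_cast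
      ring_nf
    rw [e1, e2]
    set T := Complex.exp (-(Complex.I * ω * ((m + ((d + 1 : ℕ) + 1) / 2 - c) * h)))
    simp only [hz, ← hs]
    push_cast
    field_simp
    linear_combination (4 * (d + 1) * T * h * ω * s ^ (d + 1) * (C - s)) * Complex.I_sq

theorem angularFourier_normalizedBSpline {p : ℕ} {h : ℝ} (hp : 1 ≤ p) (hh : 0 < h) (ω : ℝ) :
    angularFourier (normalizedBSpline p h) ω = ((Real.sinc (h * ω / 2) ^ p : ℝ) : ℂ) := by
  have hh' : (h : ℂ) ≠ 0 := by exact_mod_cast hh.ne'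
  have hfun : angularFourier (normalizedBSpline p h) =
      fun ω => ((1 / h : ℝ) : ℂ) * angularFourier (centeredBSpline p h) ω := by
    ext ω
    exact angularFourier_const_mul (1 / h) (centeredBSpline p h) ω
  have hcont : Continuous (angularFourier (normalizedBSpline p h)) := by
    rw [hfun]
    exact continuous_const.mul (continuous_angularFourier_coxDeBoor _ _ _)
  have hcont' : Continuous fun ω : ℝ => ((Real.sinc (h * ω / 2) ^ p : ℝ) : ℂ) :=
    Complex.continuous_ofReal.comp
      ((Real.continuous_sinc.comp (by fun_prop : Continuous fun ω : ℝ => h * ω / 2)).pow p)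
  refine congrFun (hcont.ext_on (dense_compl_singleton 0) hcont' fun ω hω => ?_) ω
  have hp1 : p - 1 + 1 = p := Nat.sub_add_cancel hp
  have hp2 : (((p - 1 : ℕ) : ℂ) + 1) = p := by exact_mod_cast hp1
  rw [hfun]
  simp only [centeredBSpline]
  rw [angularFourier_coxDeBoor_of_ne_zero hh _ _ 0 hω, hp1, hp2]
  push_cast
  rw [show -(Complex.I * (ω : ℂ) * ((0 + (p : ℂ) / 2 - p / 2) * h)) = 0 by ring, Complex.exp_zero]
  field_simp

/-! ### The error in the frequency domain -/

theorem norm_angularFourier_sub {p : ℕ} {h : ℝ} (hp : 1 ≤ p) (hh : 0 < h) (ω : ℝ) :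
    ‖angularFourier (splineGaussian p h) ω - angularFourier (normalizedBSpline p h) ω‖ =
      |Real.exp (-(p * (h * |ω| / 2) ^ 2 / 6)) - Real.sinc (h * |ω| / 2) ^ p| := by
  have e : h * |ω| / 2 = |h * ω / 2| := by
    rw [abs_div, abs_mul, abs_of_pos hh, abs_two]
  rw [angularFourier_splineGaussian hp hh, angularFourier_normalizedBSpline hp hh,
    ← Complex.ofReal_sub, Complex.norm_real, Real.norm_eq_abs, e, sq_abs, sinc_abs]

theorem mainTheorem2 :
    (∀ (p : ℕ) (h ω : ℝ), 1 ≤ p → 0 < h →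
      angularFourier (normalizedBSpline p h) ω = ((Real.sinc (h * ω / 2) ^ p : ℝ) : ℂ) ∧
      (p < 13 → |ω| ≤ 2 / h * Real.sqrt (12 * Real.log p / p) →
        ‖angularFourier (splineGaussian p h) ω - angularFourier (normalizedBSpline p h) ω‖
          ≤ 4 / (5 * Real.exp 1 ^ 2 * p) * (1 + 17 * Real.log p / (7 * p))) ∧
      (13 ≤ p → |ω| < 2 / h * Real.sqrt (12 * Real.log p / p) →
        ‖angularFourier (splineGaussian p h) ω - angularFourier (normalizedBSpline p h) ω‖
          ≤ 4 / (5 * Real.exp 1 ^ 2 * p) * (1 + 17 * Real.log p / (7 * p))) ∧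
      (13 ≤ p → 2 / h * Real.sqrt (12 * Real.log p / p) ≤ |ω| → |ω| ≤ Real.pi / h →
        ‖angularFourier (splineGaussian p h) ω - angularFourier (normalizedBSpline p h) ω‖
          ≤ 4 * Real.log p ^ 2 / (5 * p ^ 3) * (1 + 17 * Real.log p / (7 * p))) ∧
      (Real.pi / h < |ω| →
        ‖angularFourier (splineGaussian p h) ω - angularFourier (normalizedBSpline p h) ω‖
          ≤ Real.exp (-(p * (h * ω) ^ 2 / 24)) + (2 / (h * |ω|)) ^ p)) ∧
    (∀ h ω : ℝ, 0 < h →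
      Tendsto (fun p : ℕ =>
        angularFourier (splineGaussian p h) ω - angularFourier (normalizedBSpline p h) ω)
        atTop (𝓝 0)) := by
  refine ⟨fun p h ω hp hh => ?_, fun h ω hh => ?_⟩
  · rw [norm_angularFourier_sub hp hh]
    have hp' : (0 : ℝ) < p := by exact_mod_cast hp
    have hx0 : 0 ≤ h * |ω| / 2 := by positivity
    have hr0 : 0 ≤ 12 * Real.log p / p := by
      have := Real.log_natCast_nonneg p
      positivity
    have hω2 : |ω| = 2 / h * (h * |ω| / 2) := by field_simp
    have hlow : |ω| ≤ 2 / h * Real.sqrt (12 * Real.log p / p) →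
        (h * |ω| / 2) ^ 2 ≤ 12 * Real.log p / p := fun hle => by
      rw [hω2, mul_le_mul_iff_right₀ (by positivity)] at hle
      exact (Real.le_sqrt hx0 hr0).1 hle
    refine ⟨angularFourier_normalizedBSpline hp hh ω,
      fun _ hle => error_le_of_sq_le hp hx0 (hlow hle),
      fun _ hlt => error_le_of_sq_le hp hx0 (hlow hlt.le), fun hp13 hge hle => ?_, fun hgt => ?_⟩
    · rw [hω2, mul_le_mul_iff_right₀ (by positivity)] at hge
      rw [le_div_iff₀ hh] at hle
      exact error_le_of_le_sq hp13 hx0 ((Real.sqrt_le_left hx0).1 hge) (by linarith)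
    · have hω : 0 < |ω| := lt_of_le_of_lt (by positivity) hgt
      refine (abs_sub _ _).trans (add_le_add (le_of_eq ?_) ?_)
      · rw [Real.abs_exp, div_pow, mul_pow, mul_pow, sq_abs]
        ring_nf
      · rw [abs_pow]
        gcongr
        refine (abs_sinc_le_inv_abs (by positivity)).trans_eq ?_
        rw [abs_of_pos (by positivity), inv_div]
  · rw [tendsto_zero_iff_norm_tendsto_zero]
    have hev : (fun p : ℕ => |Real.exp (-((h * |ω| / 2) ^ 2 / 6)) ^ p
        - Real.sinc (h * |ω| / 2) ^ p|) =ᶠ[atTop] fun p : ℕ =>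
        ‖angularFourier (splineGaussian p h) ω - angularFourier (normalizedBSpline p h) ω‖ := by
      filter_upwards [eventually_ge_atTop 1] with p hp
      rw [norm_angularFourier_sub hp hh, ← Real.exp_nat_mul]
      ring_nf
    refine Tendsto.congr' hev ?_
    rcases eq_or_ne ω 0 with rfl | hω
    · simp
    · have hx : 0 < h * |ω| / 2 := by positivity
      have h1 := tendsto_pow_atTop_nhds_zero_of_lt_one
        (Real.exp_pos (-((h * |ω| / 2) ^ 2 / 6))).le
        (Real.exp_lt_one_iff.2 (neg_neg_of_pos (by positivity)))
      have h2 := tendsto_pow_atTop_nhds_zero_of_abs_lt_one (abs_sinc_lt_one hx.ne')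
      simpa using (h1.sub h2).abs
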